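/- Let $X$ be a finite abstract simplicial complex with $n\ge 2$ vertices, and let $G_X$ denote its $1$-skeleton, i.e. the graph whose vertices and edges are the $0$- and $1$-dimensional simplices of $X$. For a complex $Y$ and $j\ge 0$ write $Y(j)$ for the set of $j$-dimensional simplices of $Y$. Suppose that $X$ is a clique complex, i.e. for every $j\ge 0$ the set $X(j)$ consists exactly of the $(j+1)$-cliques of $G_X$. Let $X'$ be a subcomplex of $X$ with the same $1$-skeleton, $G_{X'}=G_X$. For $k\ge 1$ put $$S_k(X,X') := \max_{\sigma\in X'(k)}\bigl|\{\tau\in X(k+1)\setminus X'(k+1) : \sigma\subset\tau\}\bigr|$$ (with $S_k(X,X'):=0$ if $X'(k)=\emptyset$), and let $\lambda_2(G_X)$ be the second smallest eigenvalue, counted with multiplicity, of the (unnormalized) graph Laplacian of $G_X$, i.e. of the degree matrix minus the adjacency matrix. If $k\ge 1$ and $$\lambda_2(G_X) > \frac{kn}{k+1} + \frac{k+2}{k+1}\, S_k(X,X'),$$ then the $k$-th reduced simplicial cohomology of $X'$ with real coefficients vanishes: $\widetilde H^k(X')=0$. -/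

import Mathlib

namespace FiniteComplex

section Definitions

variable {V : Type*} [DecidableEq V]

/-- The (unoriented) `k`-dimensional simplices of a finite complex, i.e. its faces with `k + 1`
vertices. -/
noncomputable def simplices [Fintype V] (X : AbstractSimplicialComplex V) (k : ℕ) :
    Finset (Finset V) :=
  open Classical in Finset.univ.filter fun s => s ∈ X ∧ s.card = k + 1

/-- The `1`-skeleton of `X`, as a graph on the vertex set of `X`. -/
def skeletonGraph (X : AbstractSimplicialComplex V) : SimpleGraph V where
  Adj u v := u ≠ v ∧ ({u, v} : Finset V) ∈ X
  symm := ⟨fun u v h => ⟨h.1.symm, by rw [Finset.pair_comm]; exact h.2⟩⟩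
  loopless := ⟨fun _ h => h.1 rfl⟩

/-- `X` is a clique complex: for all `k ≥ 0` its `k`-simplices are exactly the `(k + 1)`-cliques
of its `1`-skeleton. -/
def IsCliqueComplex [Fintype V] (X : AbstractSimplicialComplex V) : Prop :=
  ∀ (k : ℕ) (s : Finset V), s ∈ simplices X k ↔ (skeletonGraph X).IsNClique (k + 1) s

/-- The second smallest eigenvalue, with multiplicity, of the graph Laplacian (degree matrix minus
adjacency matrix). Mathlib's `eigenvalues₀` lists the eigenvalues with multiplicity in decreasing
order, at the positions `0, …, n - 1`, so it is the entry at position `n - 2`. -/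
noncomputable def spectralGap [Fintype V] [Nontrivial V] (G : SimpleGraph V) : ℝ :=
  open Classical in
  (G.isHermitian_lapMatrix (R := ℝ)).eigenvalues₀
    ⟨Fintype.card V - 2, Nat.sub_lt Fintype.card_pos Nat.two_pos⟩

/-- The maximum over the `k`-simplices `σ` of `X'` of the number of `(k + 1)`-simplices of `X`
that contain `σ` and are not in `X'` (and `0` if `X'` has no `k`-simplex). -/
noncomputable def excess [Fintype V] (X X' : AbstractSimplicialComplex V) (k : ℕ) : ℕ :=
  (simplices X' k).sup fun σ =>
    ((simplices X (k + 1) \ simplices X' (k + 1)).filter fun τ => σ ⊆ τ).card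

/-- Ordered simplices of `X` with `m` vertices, i.e. of dimension `m - 1`. For `m = 0` this is the
single empty simplex, which Mathlib does not count among the faces. -/
def OrderedSimplex (X : AbstractSimplicialComplex V) (m : ℕ) : Type _ :=
  {v : Fin m → V // Function.Injective v ∧ (m = 0 ∨ Finset.univ.image v ∈ X)}

namespace OrderedSimplex

variable {X : AbstractSimplicialComplex V} {m : ℕ}

/-- The ordered simplex `[v (π 0), …, v (π (m - 1))]`. -/
def reorder (s : OrderedSimplex X m) (π : Equiv.Perm (Fin m)) : OrderedSimplex X m :=
  ⟨fun i => s.1 (π i), s.2.1.comp π.injective, s.2.2.imp_right fun h => by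
    have e : Finset.univ.image (fun i => s.1 (π i)) = Finset.univ.image s.1 := by
      ext x
      simp only [Finset.mem_image, Finset.mem_univ, true_and]
      exact π.surjective.exists (p := fun i => s.1 i = x) |>.symm
    rw [e]; exact h⟩

/-- The `j`-th face, obtained by deleting the vertex at position `j`. -/
def face (s : OrderedSimplex X (m + 1)) (j : Fin (m + 1)) : OrderedSimplex X m :=
  ⟨fun i => s.1 (j.succAbove i), s.2.1.comp Fin.succAbove_right_injective, by
    rcases Nat.eq_zero_or_pos m with h | h
    · exact Or.inl h
    · right
      have hs := s.2.2.resolve_left (Nat.succ_ne_zero m)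
      refine (X.isRelLowerSet_faces hs).2 ?_ ?_
      · intro x hx
        simp only [Finset.mem_image, Finset.mem_univ, true_and] at hx ⊢
        obtain ⟨i, rfl⟩ := hx
        exact ⟨_, rfl⟩
      · exact ⟨_, Finset.mem_image_of_mem _ (Finset.mem_univ (⟨0, h⟩ : Fin m))⟩⟩

/-- Faces of a reordered simplex are reordered faces, with the expected sign. -/
theorem face_reorder (s : OrderedSimplex X (m + 1)) (π : Equiv.Perm (Fin (m + 1)))
    (j : Fin (m + 1)) : ∃ τ : Equiv.Perm (Fin m),
      (s.reorder π).face j = (s.face (π j)).reorder τ ∧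
      (-1 : ℝ) ^ (j : ℕ) * ((Equiv.Perm.sign τ : ℤ) : ℝ) =
        ((Equiv.Perm.sign π : ℤ) : ℝ) * (-1 : ℝ) ^ ((π j : Fin (m + 1)) : ℕ) := by
  set σ : Equiv.Perm (Fin (m + 1)) := (π j).cycleRange * π * j.cycleRange⁻¹ with hσ
  obtain ⟨⟨p, τ⟩, hp⟩ := (Equiv.Perm.decomposeFin (n := m)).symm.surjective σ
  have h0 : σ 0 = 0 := by
    simp [hσ, Equiv.Perm.mul_apply, Equiv.Perm.inv_def]
  have hp0 : p = 0 := by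
    rw [← hp, Equiv.Perm.decomposeFin_symm_apply_zero] at h0; exact h0
  subst hp0
  refine ⟨τ, ?_, ?_⟩
  · apply Subtype.ext
    funext i
    change s.1 (π (j.succAbove i)) = s.1 ((π j).succAbove (τ i))
    have h1 : σ i.succ = (τ i).succ := by
      rw [← hp, Equiv.Perm.decomposeFin_symm_apply_succ]; simp
    rw [← Fin.cycleRange_symm_succ, ← Fin.cycleRange_symm_succ, ← h1]
    simp [hσ, Equiv.Perm.mul_apply, Equiv.Perm.inv_def]
  · have hs : Equiv.Perm.sign σ = Equiv.Perm.sign τ := by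
      rw [← hp, Equiv.Perm.decomposeFin.symm_sign]; simp
    rw [← hs, hσ]
    simp only [map_mul, Equiv.Perm.sign_inv, Fin.sign_cycleRange]
    push_cast
    have : ((-1 : ℝ) ^ (j : ℕ)) * (-1) ^ (j : ℕ) = 1 := by
      rw [← mul_pow]; simp
    linear_combination ((-1 : ℝ) ^ ((π j : Fin (m + 1)) : ℕ)
      * ((Equiv.Perm.sign π : ℤ) : ℝ)) * this

end OrderedSimplex

/-- The real cochains of dimension `m - 1`: functions on ordered simplices with `m` vertices that
change by the sign of the permutation when the vertices are permuted. For `m = 0` this is a copy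
of `ℝ` (functions on the empty simplex). -/
def cochains (X : AbstractSimplicialComplex V) (m : ℕ) : Submodule ℝ (OrderedSimplex X m → ℝ) where
  carrier := {φ | ∀ (s : OrderedSimplex X m) (π : Equiv.Perm (Fin m)),
    φ (s.reorder π) = ((Equiv.Perm.sign π : ℤ) : ℝ) * φ s}
  add_mem' {φ ψ} hφ hψ s π := by
    simp only [Pi.add_apply, hφ s π, hψ s π, mul_add]
  zero_mem' s π := by simp
  smul_mem' c φ hφ s π := by
    simp only [Pi.smul_apply, smul_eq_mul, hφ s π]; ring

/-- The real vector space of cochains of dimension `m - 1`. -/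
def Cochain (X : AbstractSimplicialComplex V) (m : ℕ) : Type _ := cochains X m

noncomputable instance (X : AbstractSimplicialComplex V) (m : ℕ) : AddCommGroup (Cochain X m) :=
  inferInstanceAs (AddCommGroup (cochains X m))

noncomputable instance (X : AbstractSimplicialComplex V) (m : ℕ) : Module ℝ (Cochain X m) :=
  inferInstanceAs (Module ℝ (cochains X m))

/-- The coboundary operator from cochains of dimension `m - 1` to cochains of dimension `m`:
`(δ φ)(s) = ∑ⱼ (-1)ʲ φ(sⱼ)`, with `sⱼ` the `j`-th face of `s`. -/
noncomputable def coboundary (X : AbstractSimplicialComplex V) (m : ℕ) :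
    Cochain X m →ₗ[ℝ] Cochain X (m + 1) where
  toFun φ := ⟨fun s => ∑ j : Fin (m + 1), (-1 : ℝ) ^ (j : ℕ) * φ.1 (s.face j), by
    intro s π
    rw [Finset.mul_sum, ← Equiv.sum_comp π
      (fun j => ((Equiv.Perm.sign π : ℤ) : ℝ) * ((-1 : ℝ) ^ (j : ℕ) * φ.1 (s.face j)))]
    refine Finset.sum_congr rfl fun j _ => ?_
    obtain ⟨τ, h1, h2⟩ := s.face_reorder π j
    rw [h1, φ.2 (s.face (π j)) τ, ← mul_assoc, h2, mul_assoc]⟩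
  map_add' φ ψ := by
    apply Subtype.ext
    funext s
    change ∑ j : Fin (m + 1), (-1 : ℝ) ^ (j : ℕ) * (φ.1 (s.face j) + ψ.1 (s.face j)) =
      ∑ j : Fin (m + 1), (-1 : ℝ) ^ (j : ℕ) * φ.1 (s.face j) +
        ∑ j : Fin (m + 1), (-1 : ℝ) ^ (j : ℕ) * ψ.1 (s.face j)
    simp only [mul_add, Finset.sum_add_distrib]
  map_smul' c φ := by
    apply Subtype.ext
    funext s
    change ∑ j : Fin (m + 1), (-1 : ℝ) ^ (j : ℕ) * (c * φ.1 (s.face j)) =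
      c * ∑ j : Fin (m + 1), (-1 : ℝ) ^ (j : ℕ) * φ.1 (s.face j)
    rw [Finset.mul_sum]
    exact Finset.sum_congr rfl fun j _ => by ring

/-- The `k`-th reduced cohomology of `X` with real coefficients: cocycles of dimension `k`
modulo coboundaries of cochains of dimension `k - 1`. -/
abbrev ReducedCohomology (X : AbstractSimplicialComplex V) (k : ℕ) : Type _ :=
  LinearMap.ker (coboundary X (k + 1)) ⧸
    (LinearMap.range (coboundary X k)).submoduleOf (LinearMap.ker (coboundary X (k + 1)))

end Definitions

end FiniteComplex

/-! Represent a class of `X'` by a coclosed cocycle and extend it by zero to a function f on all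
(k+1)-tuples of vertices. Its coboundary in the clique complex `X` is estimated twice, with squared
norms taken as sums over ordered tuples.

From below (`mul_sum_sq_le_sum_sq_tupleCoboundary`): coclosedness says that every slice u ↦ f(u, η)
sums to zero, so λ₂ bounds its Dirichlet energy. Summed over η, the energies split into degree terms
and cross terms. The same cross terms occur in ‖δf‖² (`sum_sq_tupleCoboundary`), while the degrees
along a clique add up to at most kn plus its number of cofaces (`sum_adj_le`). Hence ‖δf‖² ≥
(k+2)((k+1)λ₂ − kn)‖f‖².

From above (`sum_sq_tupleCoboundary_le`): δf vanishes on the simplices of `X'`. On any other simplex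
Cauchy–Schwarz bounds it by its k+2 faces, and a face in the support of f lies in at most S_k such
simplices. Hence ‖δf‖² ≤ (k+2)² S_k ‖f‖². The hypothesis on λ₂ forces f = 0. -/

namespace FiniteComplex

/-! ### The variational bound for the second smallest eigenvalue. -/

open scoped RealInnerProductSpace in
/-- If a symmetric operator kills `w ≠ 0` and its second smallest eigenvalue is positive, then this
eigenvalue bounds the quadratic form below on the orthogonal complement of `w`. -/
theorem eigenvalues_mul_inner_self_le {E : Type*} [NormedAddCommGroup E] [InnerProductSpace ℝ E]
    [FiniteDimensional ℝ E] {T : E →ₗ[ℝ] E} (hT : T.IsSymmetric) {m : ℕ}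
    (hm : Module.finrank ℝ E = m) (j : Fin m) (hj : m ≤ (j : ℕ) + 2)
    (hpos : 0 < hT.eigenvalues hm j) {w x : E} (hw : T w = 0) (hw0 : w ≠ 0) (hwx : ⟪w, x⟫ = 0) :
    hT.eigenvalues hm j * ⟪x, x⟫ ≤ ⟪x, T x⟫ := by
  set b := hT.eigenvectorBasis hm with hb
  set μ := hT.eigenvalues hm with hμ
  have hT1 : ∀ i y, ⟪b i, T y⟫ = μ i * ⟪b i, y⟫ := fun i y => by
    rw [← hT (b i) y, hb, hT.apply_eigenvectorBasis hm i, inner_smul_left]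
    rfl
  have hanti : ∀ i, i ≤ j → μ j ≤ μ i := fun i hi => hT.eigenvalues_antitone hm hi
  -- A kernel vector is orthogonal to every eigenvector with nonzero eigenvalue.
  have hwb : ∀ i, i ≤ j → ⟪b i, w⟫ = 0 := fun i hi => by
    have h := hT1 i w
    rw [hw, inner_zero_right] at h
    exact (mul_eq_zero.mp h.symm).resolve_left (hpos.trans_le (hanti i hi)).ne'
  -- By `hj` at most one index lies beyond `j`, so `w` is a nonzero multiple of that eigenvector and
  -- `x` has no component along it.
  have hxb : ∀ i, ¬ i ≤ j → ⟪b i, x⟫ = 0 := fun i hi => by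
    have hother : ∀ i', i' ≠ i → ⟪b i', w⟫ = 0 := fun i' hne => hwb i' <| by
      have h1 : (i' : ℕ) ≠ i := fun h => hne (Fin.ext h)
      have h2 : ¬ (i : ℕ) ≤ j := hi
      have := i.2
      have := i'.2
      change (i' : ℕ) ≤ j
      omega
    have hi0 : ⟪b i, w⟫ ≠ 0 := fun h0 => hw0 <| by
      rw [← inner_self_eq_zero (𝕜 := ℝ), ← b.sum_inner_mul_inner w w]
      refine Finset.sum_eq_zero fun i' _ => ?_
      by_cases h : i' = i
      · rw [h, h0, mul_zero]
      · rw [hother i' h, mul_zero]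
    rw [← b.sum_inner_mul_inner w x, Finset.sum_eq_single i (fun i' _ h => by
      rw [real_inner_comm, hother i' h, zero_mul]) (by simp), real_inner_comm] at hwx
    exact (mul_eq_zero.mp hwx).resolve_left hi0
  rw [← b.sum_inner_mul_inner x x, ← b.sum_inner_mul_inner x (T x), Finset.mul_sum]
  refine Finset.sum_le_sum fun i _ => ?_
  rw [hT1, real_inner_comm (b i) x]
  by_cases hi : i ≤ j
  · nlinarith [hanti i hi, mul_self_nonneg ⟪b i, x⟫]
  · simp [hxb i hi]

theorem eigenvalues₀_mul_sum_sq_le {n : Type*} [Fintype n] [DecidableEq n] [Nonempty n]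
    {A : Matrix n n ℝ} (hA : A.IsHermitian) (h1 : A.mulVec (fun _ => 1) = 0)
    (j : Fin (Fintype.card n)) (hj : Fintype.card n ≤ (j : ℕ) + 2) (hpos : 0 < hA.eigenvalues₀ j)
    (g : n → ℝ) (hg : ∑ i, g i = 0) :
    hA.eigenvalues₀ j * ∑ i, g i ^ 2 ≤ g ⬝ᵥ A.mulVec g := by
  have h := eigenvalues_mul_inner_self_le (Matrix.isSymmetric_toEuclideanLin_iff.mpr hA)
    finrank_euclideanSpace j hj hpos (w := WithLp.toLp 2 fun _ => 1) (x := WithLp.toLp 2 g)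
    (by simp [Matrix.toLpLin_apply, h1])
    (fun h => by
      obtain ⟨i⟩ := ‹Nonempty n›
      simpa using congrArg (fun v : EuclideanSpace ℝ n => v i) h)
    (by simpa [PiLp.inner_apply] using hg)
  have e1 : inner ℝ (WithLp.toLp 2 g : EuclideanSpace ℝ n) (WithLp.toLp 2 g) = ∑ i, g i ^ 2 := by
    rw [PiLp.inner_apply]
    simp [sq]
  have e2 : inner ℝ (WithLp.toLp 2 g : EuclideanSpace ℝ n)
      (Matrix.toEuclideanLin A (WithLp.toLp 2 g)) = g ⬝ᵥ A.mulVec g := by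
    simp [PiLp.inner_apply, Matrix.toLpLin_apply, dotProduct, mul_comm]
  rwa [e1, e2] at h

-- The Laplacian kills constants, so the general bound applies with the constant vector. The double
-- sum meets each edge twice, hence the division by 2.
open scoped Classical in
theorem spectralGap_mul_sum_sq_le {V : Type*} [DecidableEq V] [Fintype V] [Nontrivial V]
    (G : SimpleGraph V) (hpos : 0 < spectralGap G) (g : V → ℝ) (hg : ∑ u, g u = 0) :
    spectralGap G * ∑ u, g u ^ 2 ≤
      (∑ u, ∑ v, if G.Adj u v then (g u - g v) ^ 2 else 0) / 2 := by
  have h := eigenvalues₀_mul_sum_sq_le (G.isHermitian_lapMatrix (R := ℝ))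
    (SimpleGraph.lapMatrix_mulVec_const_eq_zero G)
    ⟨Fintype.card V - 2, Nat.sub_lt Fintype.card_pos Nat.two_pos⟩ (by simp; omega) hpos g hg
  rw [← Matrix.toLinearMap₂'_apply', SimpleGraph.lapMatrix_toLinearMap₂'] at h
  exact h

/-! ### Alternating functions on tuples and their coboundaries. -/

section Tuples

variable {V : Type*} {m : ℕ}

/-- A function of `m` variables that changes by the sign of a permutation of the variables. -/
def IsAlternating (F : (Fin m → V) → ℝ) : Prop :=
  ∀ τ (π : Equiv.Perm (Fin m)), F (τ ∘ π) = ((Equiv.Perm.sign π : ℤ) : ℝ) * F τ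

/-- The coboundary of a function of `m` variables. -/
def tupleCoboundary (f : (Fin m → V) → ℝ) (τ : Fin (m + 1) → V) : ℝ :=
  ∑ j : Fin (m + 1), (-1 : ℝ) ^ (j : ℕ) * f (τ ∘ j.succAbove)

theorem sum_comp_perm [Fintype V] (F : (Fin m → V) → ℝ) (π : Equiv.Perm (Fin m)) :
    ∑ τ, F (τ ∘ π) = ∑ τ, F τ :=
  (Equiv.arrowCongr π.symm (Equiv.refl V)).sum_comp F

theorem sum_cons [Fintype V] (F : (Fin (m + 1) → V) → ℝ) :
    ∑ τ, F τ = ∑ σ : Fin m → V, ∑ u, F (Fin.cons u σ) := by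
  rw [← (Fin.consEquiv fun _ => V).sum_comp F, Fintype.sum_prod_type, Finset.sum_comm]
  rfl

theorem sign_mul_sign (π : Equiv.Perm (Fin m)) :
    ((Equiv.Perm.sign π : ℤ) : ℝ) * ((Equiv.Perm.sign π : ℤ) : ℝ) = 1 := by
  rcases Int.units_eq_one_or (Equiv.Perm.sign π) with h | h <;> simp [h]

theorem IsAlternating.sq_comp {F : (Fin m → V) → ℝ} (hF : IsAlternating F) (τ : Fin m → V)
    (π : Equiv.Perm (Fin m)) : F (τ ∘ π) ^ 2 = F τ ^ 2 := by
  rw [hF τ π]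
  linear_combination F τ ^ 2 * sign_mul_sign π

/-- The cycle moves entry `j` to the front and keeps the order of the others, which reduces every
face to the one omitting the first entry. -/
theorem comp_cycleRange_symm_comp_succ (τ : Fin (m + 1) → V) (j : Fin (m + 1)) :
    (τ ∘ j.cycleRange.symm) ∘ Fin.succ = τ ∘ j.succAbove := by
  funext i
  simp

/-- Integrating an alternating function against a coboundary, all faces contribute equally. -/
theorem IsAlternating.sum_mul_tupleCoboundary [Fintype V] {F : (Fin (m + 1) → V) → ℝ} (hF : IsAlternating F)
    (g : (Fin m → V) → ℝ) :
    ∑ τ, F τ * tupleCoboundary g τ = (m + 1) * ∑ τ, F τ * g (τ ∘ Fin.succ) := by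
  -- The sign of the cycle is (-1)^j and cancels the sign of the `j`-th face.
  have h : ∀ j : Fin (m + 1), ∑ τ, F τ * ((-1 : ℝ) ^ (j : ℕ) * g (τ ∘ j.succAbove)) =
      ∑ τ, F τ * g (τ ∘ Fin.succ) := fun j => by
    rw [← sum_comp_perm (fun τ => F τ * g (τ ∘ Fin.succ)) j.cycleRange.symm]
    refine Finset.sum_congr rfl fun τ _ => ?_
    rw [comp_cycleRange_symm_comp_succ, hF, Equiv.Perm.sign_symm, Fin.sign_cycleRange]
    push_cast
    ring
  simp only [tupleCoboundary, Finset.mul_sum]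
  rw [Finset.sum_comm, Finset.sum_congr rfl fun j _ => h j]
  simp [Finset.mul_sum]

theorem sum_mul_sq_face [Fintype V] {f : (Fin m → V) → ℝ} {w : (Fin (m + 1) → V) → ℝ}
    (hw : ∀ τ (π : Equiv.Perm (Fin (m + 1))), w (τ ∘ π) = w τ) (j : Fin (m + 1)) :
    ∑ τ, w τ * f (τ ∘ j.succAbove) ^ 2 = ∑ τ, w τ * f (τ ∘ Fin.succ) ^ 2 := by
  rw [← sum_comp_perm (fun τ => w τ * f (τ ∘ Fin.succ) ^ 2) j.cycleRange.symm]
  simp only [comp_cycleRange_symm_comp_succ, hw]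

end Tuples
-- Tuples spanning cliques and the lower bound for the coboundary.
section CliqueTuples

variable {V : Type*} {m : ℕ}

/-- The entries of `τ` are pairwise adjacent. -/
def IsCliqueTuple (G : SimpleGraph V) (τ : Fin m → V) : Prop :=
  Pairwise fun i j => G.Adj (τ i) (τ j)

variable {G : SimpleGraph V}

theorem IsCliqueTuple.comp_perm {τ : Fin m → V} (h : IsCliqueTuple G τ)
    (π : Equiv.Perm (Fin m)) : IsCliqueTuple G (τ ∘ π) :=
  fun _ _ hij => h (π.injective.ne hij)

theorem isCliqueTuple_comp_perm {τ : Fin m → V} (π : Equiv.Perm (Fin m)) :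
    IsCliqueTuple G (τ ∘ π) ↔ IsCliqueTuple G τ := by
  refine ⟨fun h => ?_, fun h => h.comp_perm π⟩
  convert h.comp_perm π⁻¹
  funext i
  simp

theorem isCliqueTuple_cons {u : V} {σ : Fin m → V} :
    IsCliqueTuple G (Fin.cons u σ : Fin (m + 1) → V) ↔
      (∀ i, G.Adj (σ i) u) ∧ IsCliqueTuple G σ := by
  constructor
  · intro h
    refine ⟨fun i => ?_, fun i j hij => ?_⟩
    · simpa using h (Fin.succ_ne_zero i)
    · simpa using h ((Fin.succ_injective m).ne hij)
  · rintro ⟨h1, h2⟩ i j hij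
    induction i using Fin.cases with
    | zero =>
      induction j using Fin.cases with
      | zero => exact absurd rfl hij
      | succ j => simpa using (h1 j).symm
    | succ i =>
      induction j using Fin.cases with
      | zero => simpa using h1 i
      | succ j => simpa using h2 fun h => hij (congrArg Fin.succ h)

/-- The cone formula: it yields δδ = 0 by induction and separates the diagonal from the cross terms
in ‖δf‖². -/
theorem tupleCoboundary_cons (f : (Fin (m + 1) → V) → ℝ) (u : V) (σ : Fin (m + 1) → V) :
    tupleCoboundary f (Fin.cons u σ) =
      f σ - tupleCoboundary (fun η : Fin m → V => f (Fin.cons u η)) σ := by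
  have h : ∀ j : Fin (m + 1), (Fin.cons u σ : Fin (m + 2) → V) ∘ j.succ.succAbove =
      Fin.cons u (σ ∘ j.succAbove) := fun j => by
    funext i
    induction i using Fin.cases <;> simp
  have h0 : (Fin.cons u σ : Fin (m + 2) → V) ∘ Fin.succ = σ := by
    funext i
    simp
  rw [tupleCoboundary, Fin.sum_univ_succ]
  simp only [h, Fin.succAbove_zero, h0, Fin.val_zero, pow_zero, one_mul, Fin.val_succ, pow_succ,
    tupleCoboundary, mul_neg_one, neg_mul, Finset.sum_neg_distrib, sub_eq_add_neg]

theorem tupleCoboundary_sub (f g : (Fin m → V) → ℝ) (τ : Fin (m + 1) → V) :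
    tupleCoboundary (fun η => f η - g η) τ = tupleCoboundary f τ - tupleCoboundary g τ := by
  simp only [tupleCoboundary, mul_sub, Finset.sum_sub_distrib]

theorem tupleCoboundary_tupleCoboundary (f : (Fin m → V) → ℝ) (τ : Fin (m + 2) → V) :
    tupleCoboundary (tupleCoboundary f) τ = 0 := by
  induction m with
  | zero =>
    have h : ∀ σ : Fin 0 → V, f σ = f Fin.elim0 := fun σ => congrArg f (Subsingleton.elim _ _)
    simp [tupleCoboundary, Fin.sum_univ_succ, h]
  | succ m ih =>
    rw [← Fin.cons_self_tail τ, tupleCoboundary_cons]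
    simp only [tupleCoboundary_cons]
    rw [tupleCoboundary_sub, ih, sub_zero, sub_self]

open scoped Classical

variable [Fintype V] {k : ℕ} {f : (Fin (k + 1) → V) → ℝ}

/-- The squared norm of the coboundary of a function supported on cliques. -/
theorem sum_sq_tupleCoboundary (hsupp : ∀ σ, f σ ≠ 0 → IsCliqueTuple G σ)
    (hf : IsAlternating f)
    (hd : ∀ τ : Fin (k + 2) → V, IsCliqueTuple G τ → ∀ π : Equiv.Perm (Fin (k + 2)),
      tupleCoboundary f (τ ∘ π) = ((Equiv.Perm.sign π : ℤ) : ℝ) * tupleCoboundary f τ) :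
    ∑ τ : Fin (k + 2) → V, (if IsCliqueTuple G τ then tupleCoboundary f τ ^ 2 else 0) =
      (k + 2) * ((∑ σ, ∑ u, if IsCliqueTuple G (Fin.cons u σ : Fin (k + 2) → V)
          then f σ ^ 2 else 0) -
        (k + 1) * ∑ η : Fin k → V, ∑ u, ∑ v,
          if G.Adj u v then f (Fin.cons u η) * f (Fin.cons v η) else 0) := by
  have hF : IsAlternating fun τ : Fin (k + 2) → V =>
      if IsCliqueTuple G τ then tupleCoboundary f τ else 0 := fun τ π => by
    simp only [isCliqueTuple_comp_perm]
    split_ifs with h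
    · exact hd τ h π
    · simp
  -- For fixed `u`, pair f, restricted to the cliques that `u` extends, with the coboundary of the
  -- slice f(u, ·); all k+1 faces contribute equally.
  have hcross : ∀ u, ∑ σ, (if IsCliqueTuple G (Fin.cons u σ : Fin (k + 2) → V) then f σ else 0) *
      tupleCoboundary (fun η : Fin k → V => f (Fin.cons u η)) σ = (k + 1) * ∑ η : Fin k → V, ∑ v,
          if G.Adj u v then f (Fin.cons u η) * f (Fin.cons v η) else 0 := fun u => by
    have hFu : IsAlternating fun σ : Fin (k + 1) → V =>
        if IsCliqueTuple G (Fin.cons u σ : Fin (k + 2) → V) then f σ else 0 := fun σ π => by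
      have : (∀ i, G.Adj ((σ ∘ π) i) u) ↔ ∀ i, G.Adj (σ i) u :=
        (π.surjective.forall (p := fun i => G.Adj (σ i) u)).symm
      simp only [isCliqueTuple_cons, isCliqueTuple_comp_perm, this]
      split_ifs
      · exact hf σ π
      · simp
    rw [hFu.sum_mul_tupleCoboundary, sum_cons]
    congr 1
    refine Finset.sum_congr rfl fun η _ => Finset.sum_congr rfl fun v _ => ?_
    have h0 : (Fin.cons v η : Fin (k + 1) → V) ∘ Fin.succ = η := by
      funext i
      simp
    rw [h0]
    -- Where both factors are nonzero, `u` and `v` are each joined to the clique `η`, so (u, v, η)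
    -- is a clique exactly when `u` and `v` are adjacent.
    by_cases hu : f (Fin.cons u η) = 0
    · simp [hu]
    by_cases hv : f (Fin.cons v η) = 0
    · simp [hv]
    have hu' := isCliqueTuple_cons.mp (hsupp _ hu)
    have hv' := hsupp _ hv
    have : IsCliqueTuple G (Fin.cons u (Fin.cons v η) : Fin (k + 2) → V) ↔ G.Adj u v := by
      rw [isCliqueTuple_cons]
      refine ⟨fun h => by simpa using (h.1 0).symm, fun h => ⟨fun i => ?_, hv'⟩⟩
      induction i using Fin.cases with
      | zero => simpa using h.symm
      | succ i => simpa using hu'.1 i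
    rw [mul_comm (f (Fin.cons u η))]
    simp only [this, ite_mul, zero_mul]
  calc _ = ∑ τ : Fin (k + 2) → V, (if IsCliqueTuple G τ then tupleCoboundary f τ else 0) *
        tupleCoboundary f τ := by
        simp only [ite_mul, zero_mul, sq]
    _ = (k + 2) * ∑ σ, ∑ u, (if IsCliqueTuple G (Fin.cons u σ : Fin (k + 2) → V) then
        f σ * (f σ - tupleCoboundary (fun η : Fin k → V => f (Fin.cons u η)) σ) else 0) := by
        rw [hF.sum_mul_tupleCoboundary, sum_cons]
        push_cast
        congr 1
        · ring
        refine Finset.sum_congr rfl fun σ _ => Finset.sum_congr rfl fun u _ => ?_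
        have h0 : (Fin.cons u σ : Fin (k + 2) → V) ∘ Fin.succ = σ := by
          funext i
          simp
        rw [h0, tupleCoboundary_cons, ite_mul, zero_mul, mul_comm]
    _ = _ := by
        congr 1
        rw [Finset.sum_comm (s := Finset.univ (α := Fin k → V)), Finset.mul_sum,
          Finset.sum_congr rfl fun u _ => (hcross u).symm,
          Finset.sum_comm (s := Finset.univ (α := V)), ← Finset.sum_sub_distrib]
        refine Finset.sum_congr rfl fun σ _ => ?_
        rw [← Finset.sum_sub_distrib]
        refine Finset.sum_congr rfl fun u _ => ?_
        split_ifs <;> ring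

/-- For σ in the support of f, a vertex adjacent to all k+1 entries extends the clique and gets its
extra unit from the last sum; any other vertex is adjacent to at most k entries. By alternation
every position contributes as much as position 0. -/
theorem sum_adj_le (hsupp : ∀ σ, f σ ≠ 0 → IsCliqueTuple G σ) (hf : IsAlternating f) :
    (k + 1) * ∑ σ : Fin (k + 1) → V, ∑ u, (if G.Adj (σ 0) u then f σ ^ 2 else 0) ≤
      k * Fintype.card V * ∑ σ, f σ ^ 2 +
      ∑ σ, ∑ u, if IsCliqueTuple G (Fin.cons u σ : Fin (k + 2) → V) then f σ ^ 2 else 0 := by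
  have h1 : ∀ i : Fin (k + 1), ∑ σ : Fin (k + 1) → V, ∑ u,
      (if G.Adj (σ i) u then f σ ^ 2 else 0) =
      ∑ σ : Fin (k + 1) → V, ∑ u, (if G.Adj (σ 0) u then f σ ^ 2 else 0) := fun i => by
    rw [← sum_comp_perm (fun σ => ∑ u, (if G.Adj (σ 0) u then f σ ^ 2 else 0)) (Equiv.swap 0 i)]
    simp [hf.sq_comp]
  have h2 : (k + 1) * ∑ σ : Fin (k + 1) → V, ∑ u, (if G.Adj (σ 0) u then f σ ^ 2 else 0) =
      ∑ σ : Fin (k + 1) → V, ∑ u, ∑ i, (if G.Adj (σ i) u then f σ ^ 2 else 0) := by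
    calc _ = ∑ i : Fin (k + 1), ∑ σ : Fin (k + 1) → V, ∑ u,
          (if G.Adj (σ i) u then f σ ^ 2 else 0) := by
          rw [Finset.sum_congr rfl fun i _ => h1 i]
          simp
      _ = _ := by
          rw [Finset.sum_comm]
          exact Finset.sum_congr rfl fun σ _ => Finset.sum_comm
  rw [h2, Finset.mul_sum, ← Finset.sum_add_distrib]
  refine Finset.sum_le_sum fun σ _ => ?_
  have h3 : k * Fintype.card V * f σ ^ 2 = ∑ _u : V, k * f σ ^ 2 := by
    simp
    ring
  rw [h3, ← Finset.sum_add_distrib]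
  refine Finset.sum_le_sum fun u _ => ?_
  by_cases hσ : f σ = 0
  · simp [hσ]
  have hcl := hsupp σ hσ
  by_cases hall : ∀ i, G.Adj (σ i) u
  · rw [if_pos (isCliqueTuple_cons.mpr ⟨hall, hcl⟩)]
    simp only [hall, if_true, Finset.sum_const, Finset.card_univ, Fintype.card_fin, nsmul_eq_mul]
    push_cast
    linarith
  · rw [if_neg fun h => hall (isCliqueTuple_cons.mp h).1, add_zero]
    push Not at hall
    obtain ⟨i, hi⟩ := hall
    rw [← Finset.add_sum_erase _ _ (Finset.mem_univ i), if_neg hi, zero_add]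
    refine (Finset.sum_le_card_nsmul _ _ (f σ ^ 2) fun j _ => ?_).trans ?_
    · split_ifs
      · exact le_rfl
      · positivity
    · simp

/-- This is the gap inequality for each slice u ↦ f(u, η), with the square expanded, summed over η.
-/
theorem spectralGap_mul_sum_sq_le_sub [DecidableEq V] [Nontrivial V] (hpos : 0 < spectralGap G)
    (hsum : ∀ η : Fin k → V, ∑ u, f (Fin.cons u η) = 0) :
    spectralGap G * ∑ σ, f σ ^ 2 ≤
      (∑ σ : Fin (k + 1) → V, ∑ u, if G.Adj (σ 0) u then f σ ^ 2 else 0) -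
        ∑ η : Fin k → V, ∑ u, ∑ v,
          if G.Adj u v then f (Fin.cons u η) * f (Fin.cons v η) else 0 := by
  rw [sum_cons, sum_cons, Finset.mul_sum, ← Finset.sum_sub_distrib]
  refine Finset.sum_le_sum fun η _ => (spectralGap_mul_sum_sq_le G hpos _ (hsum η)).trans_eq ?_
  set g : V → ℝ := fun u => f (Fin.cons u η)
  have h1 : ∑ u, ∑ v, (if G.Adj u v then g v ^ 2 else 0) =
      ∑ u, ∑ v, (if G.Adj u v then g u ^ 2 else 0) := by
    rw [Finset.sum_comm]
    simp only [G.adj_comm]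
  have h2 : ∑ u, ∑ v, (if G.Adj u v then (g u - g v) ^ 2 else 0) =
      ∑ u, ∑ v, (if G.Adj u v then g u ^ 2 else 0) +
      ∑ u, ∑ v, (if G.Adj u v then g v ^ 2 else 0) -
      2 * ∑ u, ∑ v, (if G.Adj u v then g u * g v else 0) := by
    simp only [Finset.mul_sum, ← Finset.sum_add_distrib, ← Finset.sum_sub_distrib]
    refine Finset.sum_congr rfl fun u _ => Finset.sum_congr rfl fun v _ => ?_
    split_ifs <;> ring
  rw [h2, h1]
  simp only [Fin.cons_zero]
  change _ = ∑ u, ∑ v, (if G.Adj u v then g u ^ 2 else 0) -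
    ∑ u, ∑ v, (if G.Adj u v then g u * g v else 0)
  ring

/-- The lower bound for the coboundary of a coclosed cochain of a clique complex. -/
theorem mul_sum_sq_le_sum_sq_tupleCoboundary [DecidableEq V] [Nontrivial V]
    (hpos : 0 < spectralGap G)
    (hsupp : ∀ σ, f σ ≠ 0 → IsCliqueTuple G σ) (hf : IsAlternating f)
    (hd : ∀ τ : Fin (k + 2) → V, IsCliqueTuple G τ → ∀ π : Equiv.Perm (Fin (k + 2)),
      tupleCoboundary f (τ ∘ π) = ((Equiv.Perm.sign π : ℤ) : ℝ) * tupleCoboundary f τ)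
    (hsum : ∀ η : Fin k → V, ∑ u, f (Fin.cons u η) = 0) :
    (k + 2) * (((k + 1) * spectralGap G - k * Fintype.card V) * ∑ σ, f σ ^ 2) ≤
      ∑ τ : Fin (k + 2) → V, (if IsCliqueTuple G τ then tupleCoboundary f τ ^ 2 else 0) := by
  rw [sum_sq_tupleCoboundary hsupp hf hd]
  have h1 := sum_adj_le hsupp hf
  -- The factor k+1 matches the coefficient of the cross terms in ‖δf‖², so they cancel.
  have h2 := mul_le_mul_of_nonneg_left (spectralGap_mul_sum_sq_le_sub hpos hsum)
    (by positivity : (0 : ℝ) ≤ k + 1)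
  refine mul_le_mul_of_nonneg_left ?_ (by positivity)
  linarith

end CliqueTuples
-- Auxiliary facts on slice sums, clique tuples and simplices.
section Alternating

variable {V : Type*} {m : ℕ}

theorem isAlternating_sum_cons [Fintype V] {f : (Fin (m + 1) → V) → ℝ} (hf : IsAlternating f) :
    IsAlternating fun η : Fin m → V => ∑ u, f (Fin.cons u η) := by
  intro η π
  rw [Finset.mul_sum]
  refine Finset.sum_congr rfl fun u _ => ?_
  -- This permutation fixes the new position 0, acts as `π` on the others, and has the same sign.
  have h := hf (Fin.cons u η) (Equiv.Perm.decomposeFin.symm (0, π))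
  rw [Equiv.Perm.decomposeFin.symm_sign, if_pos rfl, one_mul] at h
  rw [← h]
  congr 1
  funext i
  induction i using Fin.cases <;> simp

theorem IsCliqueTuple.injective {G : SimpleGraph V} {τ : Fin m → V} (h : IsCliqueTuple G τ) :
    Function.Injective τ := fun i j hij => by
  by_contra hne
  exact (h hne).ne hij

theorem mem_simplices [Fintype V] {X : AbstractSimplicialComplex V} {k : ℕ} {s : Finset V} :
    s ∈ simplices X k ↔ s ∈ X ∧ s.card = k + 1 := by
  simp [simplices]

end Alternating

/-! ### Cochains as functions on tuples, and coclosed representatives. -/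

section Extension

variable {V : Type*} [DecidableEq V] {X : AbstractSimplicialComplex V} {m : ℕ}

open scoped Classical in
/-- The extension of a cochain by zero to all tuples of vertices. -/
noncomputable def extendByZero (φ : Cochain X m) (v : Fin m → V) : ℝ :=
  if h : Function.Injective v ∧ (m = 0 ∨ Finset.univ.image v ∈ X) then φ.1 ⟨v, h⟩ else 0

theorem extendByZero_coe (φ : Cochain X m) (s : OrderedSimplex X m) :
    extendByZero φ s.1 = φ.1 s :=
  dif_pos s.2

theorem extendByZero_of_not (φ : Cochain X m) {v : Fin m → V}
    (h : ¬ (Function.Injective v ∧ (m = 0 ∨ Finset.univ.image v ∈ X))) :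
    extendByZero φ v = 0 :=
  dif_neg h

theorem of_extendByZero_ne_zero {φ : Cochain X (m + 1)} {v : Fin (m + 1) → V}
    (h : extendByZero φ v ≠ 0) : Function.Injective v ∧ Finset.univ.image v ∈ X := by
  by_contra hv
  exact h (extendByZero_of_not φ fun hv' => hv ⟨hv'.1, hv'.2.resolve_left (Nat.succ_ne_zero m)⟩)

theorem image_comp_perm (v : Fin m → V) (π : Equiv.Perm (Fin m)) :
    Finset.univ.image (v ∘ π) = Finset.univ.image v := by
  ext x
  simp only [Finset.mem_image, Finset.mem_univ, true_and, Function.comp_apply]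
  exact π.surjective.exists (p := fun i => v i = x) |>.symm

theorem isAlternating_extendByZero (φ : Cochain X m) : IsAlternating (extendByZero φ) := by
  intro v π
  by_cases h : Function.Injective v ∧ (m = 0 ∨ Finset.univ.image v ∈ X)
  · have h1 := extendByZero_coe φ (OrderedSimplex.reorder ⟨v, h⟩ π)
    exact h1.trans ((φ.2 _ π).trans (congrArg _ (extendByZero_coe φ ⟨v, h⟩).symm))
  · rw [extendByZero_of_not φ h, extendByZero_of_not φ, mul_zero]
    rwa [image_comp_perm, π.injective_comp]

theorem coboundary_apply (φ : Cochain X m) (s : OrderedSimplex X (m + 1)) :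
    (coboundary X m φ).1 s = tupleCoboundary (extendByZero φ) s.1 := by
  change ∑ j : Fin (m + 1), (-1 : ℝ) ^ (j : ℕ) * φ.1 (s.face j) = _
  exact Finset.sum_congr rfl fun j _ => congrArg _ (extendByZero_coe φ (s.face j)).symm

theorem coboundary_coboundary (φ : Cochain X m) :
    coboundary X (m + 1) (coboundary X m φ) = 0 := by
  refine Subtype.ext (funext fun s => ?_)
  refine Eq.trans ?_ (tupleCoboundary_tupleCoboundary (extendByZero φ) s.1)
  change ∑ j : Fin (m + 2), (-1 : ℝ) ^ (j : ℕ) * (coboundary X m φ).1 (s.face j) = _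
  exact Finset.sum_congr rfl fun j _ => congrArg _ (coboundary_apply φ (s.face j))

/-- The restriction to the simplices of `X` of an alternating function. -/
def restrictTuples (X : AbstractSimplicialComplex V) {g : (Fin m → V) → ℝ}
    (hg : IsAlternating g) : Cochain X m :=
  ⟨fun s => g s.1, fun s π => hg s.1 π⟩

theorem coboundary_restrictTuples {g : (Fin m → V) → ℝ} (hg : IsAlternating g)
    (s : OrderedSimplex X (m + 1)) :
    (coboundary X m (restrictTuples X hg)).1 s = tupleCoboundary g s.1 :=
  rfl

/-- The coboundary of an alternating function on tuples is alternating at the tuples spanning a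
simplex. -/
theorem tupleCoboundary_comp_perm {g : (Fin m → V) → ℝ} (hg : IsAlternating g)
    (s : OrderedSimplex X (m + 1)) (π : Equiv.Perm (Fin (m + 1))) :
    tupleCoboundary g (s.1 ∘ π) = ((Equiv.Perm.sign π : ℤ) : ℝ) * tupleCoboundary g s.1 :=
  (coboundary X m (restrictTuples X hg)).2 s π

/-- Extension by zero as a linear map to a Euclidean space. -/
noncomputable def extendByZeroₗ (X : AbstractSimplicialComplex V) (m : ℕ) :
    Cochain X m →ₗ[ℝ] EuclideanSpace ℝ (Fin m → V) where
  toFun φ := WithLp.toLp 2 (extendByZero φ)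
  map_add' φ ψ := by
    ext v
    simp only [PiLp.add_apply, extendByZero]
    split_ifs
    · rfl
    · simp
  map_smul' c φ := by
    ext v
    simp only [PiLp.smul_apply, extendByZero]
    split_ifs
    · rfl
    · simp

/-- A cochain orthogonal to all coboundaries is coclosed. -/
theorem sum_cons_eq_zero_of_orthogonal [Fintype V] {φ : Cochain X (m + 1)}
    (h : ∀ γ : Cochain X m,
      ∑ τ, extendByZero φ τ * extendByZero (coboundary X m γ) τ = 0) (η : Fin m → V) :
    ∑ u, extendByZero φ (Fin.cons u η) = 0 := by
  -- `g` is, up to a factor, the adjoint of the coboundary applied to `φ`. Testing orthogonality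
  -- against `g` itself gives (m+1)‖g‖² = 0.
  set g : (Fin m → V) → ℝ := fun η => ∑ u, extendByZero φ (Fin.cons u η)
  have hg : IsAlternating g := isAlternating_sum_cons (isAlternating_extendByZero φ)
  have h1 : ∑ τ, extendByZero φ τ * tupleCoboundary g τ = 0 := by
    rw [← h (restrictTuples X hg)]
    refine Finset.sum_congr rfl fun τ _ => ?_
    by_cases hτ : Function.Injective τ ∧ (m + 1 = 0 ∨ Finset.univ.image τ ∈ X)
    · exact congrArg _
        ((extendByZero_coe _ ⟨τ, hτ⟩).trans (coboundary_restrictTuples hg ⟨τ, hτ⟩)).symm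
    · rw [extendByZero_of_not φ hτ, zero_mul, zero_mul]
  rw [(isAlternating_extendByZero φ).sum_mul_tupleCoboundary, sum_cons] at h1
  have h2 : ∑ η : Fin m → V, ∑ u, extendByZero φ (Fin.cons u η) *
      g ((Fin.cons u η : Fin (m + 1) → V) ∘ Fin.succ) = ∑ η, g η ^ 2 := by
    refine Finset.sum_congr rfl fun η _ => ?_
    have h0 : ∀ u, (Fin.cons u η : Fin (m + 1) → V) ∘ Fin.succ = η := fun u => by
      funext i
      simp
    simp only [h0, ← Finset.sum_mul, sq]
    rfl
  rw [h2] at h1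
  have h3 := (mul_eq_zero.mp h1).resolve_left (by positivity)
  rw [Finset.sum_eq_zero_iff_of_nonneg fun _ _ => sq_nonneg _] at h3
  exact pow_eq_zero_iff two_ne_zero |>.mp (h3 η (Finset.mem_univ η))

/-- Every cohomology class has a coclosed representative. -/
theorem exists_sum_cons_sub_coboundary_eq_zero [Fintype V] (x : Cochain X (m + 1)) :
    ∃ γ : Cochain X m, ∀ η : Fin m → V,
      ∑ u, extendByZero (x - coboundary X m γ) (Fin.cons u η) = 0 := by
  -- The coclosed representative is the component of `x` orthogonal to the space of coboundaries.
  obtain ⟨y, ⟨γ, rfl⟩, z, hz, hxz⟩ :=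
    (LinearMap.range (extendByZeroₗ X (m + 1) ∘ₗ coboundary X m)).exists_add_mem_mem_orthogonal
      (extendByZeroₗ X (m + 1) x)
  refine ⟨γ, sum_cons_eq_zero_of_orthogonal fun γ' => ?_⟩
  have hz' : z = extendByZeroₗ X (m + 1) (x - coboundary X m γ) := by
    rw [map_sub, hxz, LinearMap.comp_apply, add_sub_cancel_left]
  have h := (Submodule.mem_orthogonal' _ _).mp hz _ ⟨γ', rfl⟩
  rw [hz', PiLp.inner_apply] at h
  simpa [extendByZeroₗ, mul_comm] using h

theorem eq_zero_of_sum_sq_extendByZero [Fintype V] {φ : Cochain X m}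
    (h : ∑ τ, extendByZero φ τ ^ 2 ≤ 0) : φ = 0 := by
  have h0 := le_antisymm h (Finset.sum_nonneg fun _ _ => sq_nonneg _)
  rw [Finset.sum_eq_zero_iff_of_nonneg fun _ _ => sq_nonneg _] at h0
  refine Subtype.ext (funext fun s => ?_)
  rw [← extendByZero_coe]
  exact pow_eq_zero_iff two_ne_zero |>.mp (h0 s.1 (Finset.mem_univ _))

end Extension

/-! ### The upper bound for the coboundary, and the comparison of the two bounds. -/

section Subcomplex

variable {V : Type*} [DecidableEq V] {X X' : AbstractSimplicialComplex V} {m : ℕ}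

theorem isCliqueTuple_of_image_mem {τ : Fin m → V} (hinj : Function.Injective τ)
    (h : Finset.univ.image τ ∈ X) : IsCliqueTuple (skeletonGraph X) τ := by
  intro i j hij
  refine ⟨hinj.ne hij, (X.isRelLowerSet_faces h).2 ?_ ⟨τ i, by simp⟩⟩
  intro x hx
  simp only [Finset.mem_insert, Finset.mem_singleton] at hx
  rcases hx with rfl | rfl <;> simp

variable [Fintype V]

theorem card_cofaces_le_excess {k : ℕ} {s : Finset V} (hs : s ∈ simplices X' k) :
    ((simplices X (k + 1) \ simplices X' (k + 1)).filter fun t => s ⊆ t).card ≤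
      excess X X' k :=
  Finset.le_sup (f := fun s =>
    ((simplices X (k + 1) \ simplices X' (k + 1)).filter fun t => s ⊆ t).card) hs

theorem IsCliqueComplex.image_mem (hX : IsCliqueComplex X) {τ : Fin (m + 1) → V}
    (h : IsCliqueTuple (skeletonGraph X) τ) : Finset.univ.image τ ∈ X := by
  refine (mem_simplices.mp ((hX m _).mpr ⟨?_, ?_⟩)).1
  · intro x hx y hy hxy
    simp only [Finset.coe_image, Finset.coe_univ, Set.image_univ, Set.mem_range] at hx hy
    obtain ⟨i, rfl⟩ := hx
    obtain ⟨j, rfl⟩ := hy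
    exact h fun hij => hxy (congrArg τ hij)
  · rw [Finset.card_image_of_injective _ h.injective]
    simp

open scoped Classical in
/-- The number of simplices of `X` outside `X'` that extend a simplex of `X'` by one vertex. -/
theorem card_extensions_le_excess (hX : IsCliqueComplex X) {k : ℕ} {σ : Fin (k + 1) → V}
    (hinj : Function.Injective σ) (hσ : Finset.univ.image σ ∈ X') :
    (Finset.univ.filter fun u =>
      IsCliqueTuple (skeletonGraph X) (Fin.cons u σ : Fin (k + 2) → V) ∧
        Finset.univ.image (Fin.cons u σ : Fin (k + 2) → V) ∉ X').card ≤ excess X X' k := by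
  have hmem : Finset.univ.image σ ∈ simplices X' k :=
    mem_simplices.mpr ⟨hσ, by rw [Finset.card_image_of_injective _ hinj]; simp⟩
  refine le_trans ?_ (card_cofaces_le_excess hmem)
  have himage : ∀ u, Finset.univ.image (Fin.cons u σ : Fin (k + 2) → V) =
      insert u (Finset.univ.image σ) := fun u => by
    ext x
    simp [Fin.exists_fin_succ, eq_comm]
  refine Finset.card_le_card_of_injOn
    (fun u => Finset.univ.image (Fin.cons u σ : Fin (k + 2) → V)) ?_ ?_
  · intro u hu
    simp only [Finset.coe_filter, Finset.mem_univ, true_and, Set.mem_ofPred_eq] at hu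
    simp only [Finset.coe_filter, Finset.mem_sdiff, Set.mem_ofPred_eq]
    refine ⟨⟨mem_simplices.mpr ⟨hX.image_mem hu.1, ?_⟩, fun h => hu.2 (mem_simplices.mp h).1⟩, ?_⟩
    · rw [Finset.card_image_of_injective _ hu.1.injective]
      simp
    · rw [himage]
      exact Finset.subset_insert _ _
  -- The vertex `u` is recovered from the coface as its only vertex outside `σ`.
  · intro u hu u' _ huu
    beta_reduce at huu
    simp only [Finset.coe_filter, Finset.mem_univ, true_and, Set.mem_ofPred_eq] at hu
    have hnot : u ∉ Finset.univ.image σ := fun h => by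
      obtain ⟨i, _, hi⟩ := Finset.mem_image.mp h
      exact ((isCliqueTuple_cons.mp hu.1).1 i).ne hi
    have h : u ∈ insert u' (Finset.univ.image σ) := by
      rw [← himage, ← huu]
      simp only [himage, Finset.mem_insert_self]
    exact (Finset.mem_insert.mp h).resolve_right hnot

open scoped Classical in
/-- The upper bound for the coboundary in `X` of a cocycle of `X'`. -/
theorem sum_sq_tupleCoboundary_le (hX : IsCliqueComplex X) {k : ℕ} {φ : Cochain X' (k + 1)}
    (hφ : coboundary X' (k + 1) φ = 0) :
    ∑ τ : Fin (k + 2) → V, (if IsCliqueTuple (skeletonGraph X) τ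
      then tupleCoboundary (extendByZero φ) τ ^ 2 else 0) ≤
      (k + 2) ^ 2 * (excess X X' k * ∑ σ, extendByZero φ σ ^ 2) := by
  set f := extendByZero φ
  set w : (Fin (k + 2) → V) → ℝ := fun τ =>
    if IsCliqueTuple (skeletonGraph X) τ ∧ Finset.univ.image τ ∉ X' then 1 else 0 with hw
  have hwperm : ∀ τ (π : Equiv.Perm (Fin (k + 2))), w (τ ∘ π) = w τ := fun τ π => by
    simp only [hw, isCliqueTuple_comp_perm, image_comp_perm]
  have h1 : ∀ τ : Fin (k + 2) → V,
      (if IsCliqueTuple (skeletonGraph X) τ then tupleCoboundary f τ ^ 2 else 0) ≤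
      (k + 2) * ∑ j : Fin (k + 2), w τ * f (τ ∘ j.succAbove) ^ 2 := fun τ => by
    rw [← Finset.mul_sum]
    by_cases hc : IsCliqueTuple (skeletonGraph X) τ
    · rw [if_pos hc]
      -- On `X'` the cocycle condition applies; elsewhere Cauchy–Schwarz over the k+2 faces gives
      -- the factor k+2.
      by_cases hτ : Finset.univ.image τ ∈ X'
      · have hs := coboundary_apply φ ⟨τ, hc.injective, Or.inr hτ⟩
        rw [hφ] at hs
        have h0 : tupleCoboundary f τ = 0 := hs.symm
        simp [hw, hτ, h0]
      · have hle := sq_sum_le_card_mul_sum_sq (s := Finset.univ)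
          (f := fun j : Fin (k + 2) => (-1 : ℝ) ^ (j : ℕ) * f (τ ∘ j.succAbove))
        simp only [mul_pow, ← pow_mul, mul_comm _ 2, pow_mul (-1 : ℝ) 2, neg_one_sq, one_pow,
          one_mul, Finset.card_univ, Fintype.card_fin, Nat.cast_add, Nat.cast_ofNat] at hle
        simp only [hw, hc, hτ, not_false_eq_true, and_self, if_true, one_mul]
        exact hle
    · simp [hw, hc]
  have h2 : ∑ τ, w τ * f (τ ∘ Fin.succ) ^ 2 ≤ excess X X' k * ∑ σ, f σ ^ 2 := by
    rw [sum_cons, Finset.mul_sum]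
    refine Finset.sum_le_sum fun σ _ => ?_
    have h0 : ∀ u, (Fin.cons u σ : Fin (k + 2) → V) ∘ Fin.succ = σ := fun u => by
      funext i
      simp
    simp only [h0, ← Finset.sum_mul]
    by_cases hσ : f σ = 0
    · simp [hσ]
    · refine mul_le_mul_of_nonneg_right ?_ (sq_nonneg _)
      obtain ⟨hinj, him⟩ := of_extendByZero_ne_zero hσ
      have := card_extensions_le_excess hX hinj him
      simp only [hw, Finset.sum_boole]
      exact_mod_cast this
  calc _ ≤ ∑ τ : Fin (k + 2) → V, (k + 2) * ∑ j : Fin (k + 2), w τ * f (τ ∘ j.succAbove) ^ 2 :=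
        Finset.sum_le_sum fun τ _ => h1 τ
    _ = (k + 2) ^ 2 * ∑ τ, w τ * f (τ ∘ Fin.succ) ^ 2 := by
        rw [← Finset.mul_sum, Finset.sum_comm,
          Finset.sum_congr rfl fun j _ => sum_mul_sq_face hwperm j]
        simp
        ring
    _ ≤ _ := mul_le_mul_of_nonneg_left h2 (by positivity)

theorem eq_zero_of_harmonic [Nontrivial V] (hX : IsCliqueComplex X) (hX' : X' ≤ X) {k : ℕ}
    (hgap : spectralGap (skeletonGraph X) >
      (k : ℝ) * (Fintype.card V : ℝ) / ((k : ℝ) + 1) +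
        ((k : ℝ) + 2) / ((k : ℝ) + 1) * (excess X X' k : ℝ))
    {φ : Cochain X' (k + 1)} (hφ : coboundary X' (k + 1) φ = 0)
    (hsum : ∀ η : Fin k → V, ∑ u, extendByZero φ (Fin.cons u η) = 0) : φ = 0 := by
  have hpos : 0 < spectralGap (skeletonGraph X) := lt_of_le_of_lt (by positivity) hgap
  have hlower := mul_sum_sq_le_sum_sq_tupleCoboundary hpos
    (fun σ hσ => isCliqueTuple_of_image_mem (of_extendByZero_ne_zero hσ).1
      (hX' (of_extendByZero_ne_zero hσ).2))
    (isAlternating_extendByZero φ)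
    -- A clique tuple spans a simplex of `X`, possibly not of `X'`, so the sign rule comes from
    -- cochains on `X`.
    (fun τ hτ π => tupleCoboundary_comp_perm (isAlternating_extendByZero φ)
      (⟨τ, hτ.injective, Or.inr (hX.image_mem hτ)⟩ : OrderedSimplex X (k + 2)) π)
    hsum
  have hle := hlower.trans (sum_sq_tupleCoboundary_le hX hφ)
  have hgap' : 0 < (k + 1) * spectralGap (skeletonGraph X) - k * Fintype.card V -
      (k + 2) * excess X X' k := by
    have h1 : (0 : ℝ) < k + 1 := by positivity
    have h2 := mul_lt_mul_of_pos_left hgap h1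
    have h3 : ((k : ℝ) + 1) * ((k : ℝ) * (Fintype.card V : ℝ) / ((k : ℝ) + 1) +
        ((k : ℝ) + 2) / ((k : ℝ) + 1) * (excess X X' k : ℝ)) =
        k * Fintype.card V + (k + 2) * excess X X' k := by
      field_simp
    linarith
  -- The two bounds combine to (k+2)((k+1)λ₂ − kn − (k+2)S_k)‖f‖² ≤ 0, whose coefficient is
  -- positive.
  refine eq_zero_of_sum_sq_extendByZero (le_of_mul_le_mul_left ?_
    (mul_pos (by positivity : (0 : ℝ) < k + 2) hgap'))
  linarith

end Subcomplex

end FiniteComplex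

theorem corollary1p5 {V : Type*} [Fintype V] [DecidableEq V] [Nontrivial V]
    (X X' : AbstractSimplicialComplex V)
    (hX : FiniteComplex.IsCliqueComplex X)
    (hX' : X' ≤ X)
    (hskel : FiniteComplex.skeletonGraph X' = FiniteComplex.skeletonGraph X)
    (k : ℕ) (hk : 1 ≤ k)
    (hgap : FiniteComplex.spectralGap (FiniteComplex.skeletonGraph X) >
      (k : ℝ) * (Fintype.card V : ℝ) / ((k : ℝ) + 1) +
        ((k : ℝ) + 2) / ((k : ℝ) + 1) * (FiniteComplex.excess X X' k : ℝ)) :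
    Subsingleton (FiniteComplex.ReducedCohomology X' k) := by
  refine ⟨fun a b => ?_⟩
  obtain ⟨x, rfl⟩ := Submodule.Quotient.mk_surjective _ a
  obtain ⟨y, rfl⟩ := Submodule.Quotient.mk_surjective _ b
  rw [Submodule.Quotient.eq, Submodule.submoduleOf, Submodule.mem_comap]
  obtain ⟨γ, hγ⟩ :=
    FiniteComplex.exists_sum_cons_sub_coboundary_eq_zero (x - y : FiniteComplex.Cochain X' (k + 1))
  -- The difference of the two cocycles minus δγ is closed and coclosed, hence zero, so `γ` is the
  -- required primitive.
  refine ⟨γ, (sub_eq_zero.mp (FiniteComplex.eq_zero_of_harmonic hX hX' hgap ?_ hγ)).symm⟩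
  rw [map_sub, FiniteComplex.coboundary_coboundary, sub_zero]
  exact (x - y).2
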